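/- For $\ell\ge 2$ let $P_\ell$ be the set of all one-to-one partial functions $f$ from $\mathbb N$ to $\mathbb N$ such that for all $i\in\mathrm{dom}(f)$ and all $n$, $f(i)\in[\ell^n,\ell^{n+1})$ if and only if $i\in[\ell^n,\ell^{n+1})$; for each $i\in\mathrm{dom}(f)$ the set $\{i,f(i),\dots,f^\ell(i)\}$ is defined and has precisely $\ell$ elements; and $\limsup_n|[\ell^n,\ell^{n+1})\setminus\mathrm{dom}(f)|=\infty$. Let $P_1$ be the set of all partial functions $f$ from $\mathbb N$ to $\{0,1\}$ with $\limsup_n|[2^n,2^{n+1})\setminus\mathrm{dom}(f)|=\infty$. Order $P_\ell$ by letting $f\le g$ ($f$ is stronger) if $g\setminus f$ is finite. Let $\ell\ge1$, and let $\mathfrak F\subset P_\ell$ be a generic filter over $V$. In $V[\mathfrak F]$, let $P(\mathfrak F)$ be the set of all $g\in P_\ell$ that differ only finitely from some $f\in\mathfrak F$, ordered by true extension: $g\le f$ if $g\supseteq f$. Then the following holds in $V[\mathfrak F]$. For every $P(\mathfrak F)$-name $\dot h$ that is forced to be an element of $\mathbb N^{\mathbb N}$, at least one of the following two alternatives holds.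 (1) There is $f\in\mathfrak F$ such that $f\Vdash_{P(\mathfrak F)}\dot h\restriction\mathrm{dom}(f)\notin V$. (2) There are $f\in\mathfrak F$ and an increasing sequence $n_0<n_1<\cdots$ of integers such that for each $k$, each $i\in[n_k,n_{k+1})$ and each $g\in P(\mathfrak F)$ with $g\le f$: if $g$ forces (with respect to $P(\mathfrak F)$) a value on $\dot h(i)$, then $f\cup(g\restriction[n_k,n_{k+1}))$ is a condition of $P(\mathfrak F)$ and also forces a value on $\dot h(i)$. -/

import Mathlib

open Filter

namespace TiePoint

/-! ### The posets of partial functions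

Partial functions on the natural numbers are sets of pairs, so that union, restriction and
(almost) inclusion have their set-theoretic meaning. -/

/-- Single-valuedness of a set of pairs. -/
def IsFun (f : Set (ℕ × ℕ)) : Prop := ∀ i a b, (i, a) ∈ f → (i, b) ∈ f → a = b

/-- The domain of a partial function. -/
def dom (f : Set (ℕ × ℕ)) : Set ℕ := {i | ∃ m, (i, m) ∈ f}

/-- The restriction of a partial function to a set. -/
def restr (f : Set (ℕ × ℕ)) (A : Set ℕ) : Set (ℕ × ℕ) := {x | x ∈ f ∧ x.1 ∈ A}

/-- Inclusion mod finite. -/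
def AlmostSubset (f g : Set (ℕ × ℕ)) : Prop := (f \ g).Finite

/-- Equality mod finite. -/
def AlmostEq (f g : Set (ℕ × ℕ)) : Prop := AlmostSubset f g ∧ AlmostSubset g f

/-- The `n`-th interval `[b ^ n, b ^ (n + 1))`, where `b = ℓ` for `ℓ ≥ 2` and `b = 2` for
`ℓ = 1`. -/
def level (ℓ n : ℕ) : Set ℕ := Set.Ico (max ℓ 2 ^ n) (max ℓ 2 ^ (n + 1))

/-- The conditions of `P_ℓ`: the partial functions `f` for which the numbers of elements of the
intervals that are missing from `dom f` have limsup infinity, and which moreover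
* for `ℓ = 1`, take values in `{0, 1}`;
* for `ℓ ≥ 2`, are one-to-one, preserve every interval, and satisfy that
  `{i, f i, …, f ^ ℓ i}` is defined and has precisely `ℓ` elements for every `i ∈ dom f`
  (here `c j` is the `j`-th iterate of `f` at `i`). -/
structure IsCond (ℓ : ℕ) (f : Set (ℕ × ℕ)) : Prop where
  isFun : IsFun f
  growth : ∀ m : ℕ, ∃ᶠ n in atTop, m ≤ (level ℓ n \ dom f).ncard
  two_valued : ℓ = 1 → ∀ i m, (i, m) ∈ f → m < 2
  injective : ℓ ≠ 1 → ∀ i j m, (i, m) ∈ f → (j, m) ∈ f → i = j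
  level_iff : ℓ ≠ 1 → ∀ i m, (i, m) ∈ f → ∀ n, m ∈ level ℓ n ↔ i ∈ level ℓ n
  cycle : ℓ ≠ 1 → ∀ i ∈ dom f, ∃ c : ℕ → ℕ, c 0 = i ∧
    (∀ j < ℓ, (c j, c (j + 1)) ∈ f) ∧ ((Finset.range (ℓ + 1)).image c).card = ℓ

/-- The set underlying the poset `P_ℓ`. -/
def Cond (ℓ : ℕ) : Type := {f : Set (ℕ × ℕ) // IsCond ℓ f}

/-- The graph of a condition. -/
def Cond.graph {ℓ : ℕ} (p : Cond ℓ) : Set (ℕ × ℕ) := p.1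

/-- The order of `P_ℓ`: `p` is stronger than `q`, written `p ≤ q`, if `q` is included in `p`
mod finite. -/
instance (ℓ : ℕ) : Preorder (Cond ℓ) where
  le p q := AlmostSubset q.graph p.graph
  le_refl p := by simp [AlmostSubset]
  le_trans p q r hpq hqr := by
    refine (Set.Finite.union hqr hpq).subset ?_
    intro x hx
    by_cases h : x ∈ q.graph
    · exact Or.inr ⟨h, hx.2⟩
    · exact Or.inl ⟨hx.1, h⟩

/-! ### Forcing over the ground model

The ground model `V` is the universe in which we work. A statement about the extension `V[G]`
by a generic filter `G` on the forcing notion `P` is represented by its forcing relation, that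
is, by the predicate `p ⊩ φ` on the conditions `p`, and the clauses below are the usual recursive
clauses of the forcing relation. As usual `q ≤ p` means that `q` is the stronger condition. -/

section Forcing

variable {P : Type} [Preorder P]

/-- Statements of the forcing language; `φ p` says that `p` forces `φ`. -/
abbrev Stmt (P : Type) : Type := P → Prop

/-- `φ` holds in every generic extension, that is, every condition forces `φ`. -/
def Forced (φ : Stmt P) : Prop := ∀ p, φ p

/-- A fact about objects of the ground model. -/
def ground (a : Prop) : Stmt P := fun _ => a

/-- Conjunction. -/
def fAnd (φ ψ : Stmt P) : Stmt P := fun p => φ p ∧ ψ p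

/-- Implication. -/
def fImp (φ ψ : Stmt P) : Stmt P := fun p => ∀ q ≤ p, φ q → ψ q

/-- Negation. -/
def fNot (φ : Stmt P) : Stmt P := fun p => ∀ q ≤ p, ¬ φ q

/-- Disjunction. -/
def fOr (φ ψ : Stmt P) : Stmt P := fun p => ∀ q ≤ p, ∃ r ≤ q, φ r ∨ ψ r

/-- Universal quantification over the elements of a ground model set. -/
def fAll {X : Type} (φ : X → Stmt P) : Stmt P := fun p => ∀ x, φ x p

/-- Existential quantification over the elements of a ground model set. -/
def fEx {X : Type} (φ : X → Stmt P) : Stmt P := fun p => ∀ q ≤ p, ∃ r ≤ q, ∃ x, φ x r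

/-- `P`-names for the subsets, in `V[G]`, of a ground model set `X`: sets of pairs `(x, s)`. -/
abbrev SetName (P X : Type) : Type := Set (X × P)

/-- `x ∈ τ`, where `G` evaluates `τ` as the set of all `x` with `(x, s) ∈ τ` for some `s ∈ G`. -/
def fMem {X : Type} (x : X) (τ : SetName P X) : Stmt P :=
  fun p => ∀ q ≤ p, ∃ r ≤ q, ∃ s, (x, s) ∈ τ ∧ r ≤ s

/-- The canonical name of the generic filter. -/
def genericName (P : Type) : SetName P P := {x | x.1 = x.2}

end Forcing

/-! ### The poset `P(𝔉)` in `V[𝔉]`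

From here on the forcing notion is `P_ℓ` and `𝔉` is its generic filter. The poset `P(𝔉)` is an
element of `V[𝔉]` and a subset of `V`. Its forcing relation, as computed in `V[𝔉]`, is
expressed by statements of the forcing language of `P_ℓ`. -/

section Quotient

variable {ℓ : ℕ}

/-- `f ∈ 𝔉`. -/
def inGeneric (f : Cond ℓ) : Stmt (Cond ℓ) := fMem f (genericName (Cond ℓ))

/-- `g ∈ P(𝔉)`: the condition `g` of `P_ℓ` is equal mod finite to some `f ∈ 𝔉`. -/
def inPF (g : Cond ℓ) : Stmt (Cond ℓ) :=
  fEx fun f : Cond ℓ => fAnd (inGeneric f) (ground (AlmostEq g.graph f.graph))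

/-- `φ g` for all `g ∈ P(𝔉)`. -/
def allPF (φ : Cond ℓ → Stmt (Cond ℓ)) : Stmt (Cond ℓ) :=
  fAll fun g => fImp (inPF g) (φ g)

/-- `φ g` for some `g ∈ P(𝔉)`. -/
def exPF (φ : Cond ℓ → Stmt (Cond ℓ)) : Stmt (Cond ℓ) :=
  fEx fun g => fAnd (inPF g) (φ g)

/-- `g` extends `f` in the order of `P(𝔉)`, which is true inclusion. -/
def extendsPF (g f : Cond ℓ) : Stmt (Cond ℓ) := ground (f.graph ⊆ g.graph)

/-- Statements of the forcing language of `P(𝔉)` over `V[𝔉]`; `φ g` is the statement about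
`V[𝔉]` that `g` forces `φ` with respect to `P(𝔉)`. -/
abbrev QStmt (ℓ : ℕ) : Type := Cond ℓ → Stmt (Cond ℓ)

/-- Conjunction for `P(𝔉)`. -/
def qAnd (φ ψ : QStmt ℓ) : QStmt ℓ := fun g => fAnd (φ g) (ψ g)

/-- Negation for `P(𝔉)`: no extension of `g` in `P(𝔉)` forces `φ`. -/
def qNot (φ : QStmt ℓ) : QStmt ℓ :=
  fun g => allPF fun g₁ => fImp (extendsPF g₁ g) (fNot (φ g₁))

/-- Universal quantification, for `P(𝔉)`, over a ground model set. -/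
def qAll {X : Type} (φ : X → QStmt ℓ) : QStmt ℓ := fun g => fAll fun x => φ x g

/-- Existential quantification, for `P(𝔉)`, over a ground model set: the conditions that force
some `φ x` are dense below `g`. -/
def qEx {X : Type} (φ : X → QStmt ℓ) : QStmt ℓ :=
  fun g => allPF fun g₁ => fImp (extendsPF g₁ g) <|
    exPF fun g₂ => fAnd (extendsPF g₂ g₁) (fEx fun x => φ x g₂)

/-- `P_ℓ`-names of the sets, in `V[𝔉]`, of pairs `((i, m), r)`. Such a set is read as a
`P(𝔉)`-name of a subset of `ℕ × ℕ`, pairs with `r` not in `P(𝔉)` being disregarded. -/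
abbrev RelName (ℓ : ℕ) : Type := SetName (Cond ℓ) ((ℕ × ℕ) × Cond ℓ)

/-- `h(i) = m` for `P(𝔉)`, that is, `(i, m) ∈ h`: the extensions of conditions `r` in `P(𝔉)` with
`((i, m), r) ∈ h` are dense below `g`. -/
def qVal (h : RelName ℓ) (i m : ℕ) : QStmt ℓ :=
  fun g => allPF fun g₁ => fImp (extendsPF g₁ g) <|
    exPF fun g₂ => fAnd (extendsPF g₂ g₁) <|
      exPF fun r => fAnd (fMem ((i, m), r) h) (extendsPF g₂ r)

/-- `h` is a function from `ℕ` to `ℕ`, for `P(𝔉)`. -/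
def qFunction (h : RelName ℓ) : QStmt ℓ :=
  qAnd (qAll fun i : ℕ => qEx fun m : ℕ => qVal h i m)
    (qAll fun i : ℕ => qAll fun m : ℕ => qAll fun m' : {m' : ℕ // m' ≠ m} =>
      qNot (qAnd (qVal h i m) (qVal h i m')))

/-- The restriction of `h` to the set `A` is an element of `V`, for `P(𝔉)`: it is the restriction
to `A` of some function `a : ℕ → ℕ` of the ground model. -/
def qRestrInGround (h : RelName ℓ) (A : Set ℕ) : QStmt ℓ :=
  qEx fun a : ℕ → ℕ => qAll fun i : A => qVal h i (a i)

/-- In `V[𝔉]`: the condition `g` forces a value on `h(i)` with respect to `P(𝔉)`. -/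
def decides (h : RelName ℓ) (i : ℕ) (g : Cond ℓ) : Stmt (Cond ℓ) :=
  fEx fun m : ℕ => qVal h i m g

/-- In `V[𝔉]`: every condition of `P(𝔉)` forces that `h` is a function from `ℕ` to `ℕ`. -/
def isFunctionName (h : RelName ℓ) : Stmt (Cond ℓ) := allPF fun g => qFunction h g

/-- In `V[𝔉]`: some `f ∈ 𝔉` forces, with respect to `P(𝔉)`, that the restriction of `h` to
`dom f` is not in `V`. -/
def restrictionIsNew (h : RelName ℓ) : Stmt (Cond ℓ) :=
  fEx fun f : Cond ℓ => fAnd (inGeneric f) (qNot (qRestrInGround h (dom f.graph)) f)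

/-- In `V[𝔉]`: there are `f ∈ 𝔉` and `n 0 < n 1 < …` such that for all `k`, all
`i ∈ [n k, n (k + 1))` and all `g ∈ P(𝔉)` extending `f`, if `g` forces a value on `h(i)`, then
`f ∪ (g ↾ [n k, n (k + 1)))` is in `P(𝔉)` and also forces a value on `h(i)`. The sequence `n` is
even found in `V`. -/
def decidedByBlocks (h : RelName ℓ) : Stmt (Cond ℓ) :=
  fEx fun f : Cond ℓ => fAnd (inGeneric f) <|
    fEx fun n : ℕ → ℕ => fAnd (ground (StrictMono n)) <|
      fAll fun k : ℕ => fAll fun i : Set.Ico (n k) (n (k + 1)) =>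
        allPF fun g => fImp (extendsPF g f) <| fImp (decides h i g) <|
          exPF fun c => fAnd
            (ground (c.graph = f.graph ∪ restr g.graph (Set.Ico (n k) (n (k + 1)))))
            (decides h i c)

end Quotient

end TiePoint

/-! Membership in `P_ℓ` is checked interval by interval, so conditions can be cut at an interval
boundary and glued (`Cond.mix`), and there are only finitely many initial parts up to a given
boundary. Moreover, if q forces g ∈ P(𝔉), a single condition below q and containing g can play both
roles (`exists_diagonal`), so forcing over V[𝔉] reduces to statements `qVal h i m g g`.

Suppose no condition below q forces the first alternative. Then each f ≤ q has a true extension that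
decides h on dom f by a ground model function. A fusion (`exists_fusion`) yields f and boundaries c
k such that every full initial part up to c k, continued by f, decides h i for all i up to c k. It
also ensures, for each initial part s up to c k, that either two extensions of s already split h at
some point of dom f, or no extension of f allows such a split beyond c k. Deciding h on dom f rules
out the first case for the initial parts of the deciding extension (`exists_stable`). Thus, for i
between c k and c (k + 1), the part up to c (k + 1) determines h i and the part up to c k has no
influence: only the block in between matters (`decidedByBlocks_of_stable`). -/

namespace TiePoint

/-! ### Cutting and gluing conditions; fusion. -/

section Mixing

variable {ℓ : ℕ}

/-- The index of the interval that contains `i`; zero is counted as part of the first one. -/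
def lev (ℓ i : ℕ) : ℕ := Nat.log (max ℓ 2) i

lemma one_lt_base (ℓ : ℕ) : 1 < max ℓ 2 := lt_of_lt_of_le one_lt_two (le_max_right _ _)

lemma mem_level_iff {i n : ℕ} : i ∈ level ℓ n ↔ i ≠ 0 ∧ lev ℓ i = n := by
  have hb := one_lt_base ℓ
  constructor
  · rintro ⟨h1, h2⟩
    have h0 : i ≠ 0 := by
      rintro rfl
      exact absurd h1 (not_le.2 (pow_pos (by omega) n))
    exact ⟨h0, (Nat.log_eq_iff (Or.inr ⟨hb, h0⟩)).2 ⟨h1, h2⟩⟩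
  · rintro ⟨h0, h⟩
    exact (Nat.log_eq_iff (Or.inr ⟨hb, h0⟩)).1 h

lemma level_finite (ℓ n : ℕ) : (level ℓ n).Finite := Set.finite_Ico _ _

lemma lt_lev_iff {i j : ℕ} : j < lev ℓ i ↔ max ℓ 2 ^ (j + 1) ≤ i := by
  have hb := one_lt_base ℓ
  rcases eq_or_ne i 0 with rfl | h0
  · have : 0 < max ℓ 2 ^ (j + 1) := pow_pos (by omega) _
    simp [lev]
  · exact Nat.le_log_iff_pow_le hb h0

lemma lev_le_iff {i j : ℕ} : lev ℓ i ≤ j ↔ i < max ℓ 2 ^ (j + 1) := by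
  rw [← not_lt, lt_lev_iff, not_le]

lemma dom_mono {f g : Set (ℕ × ℕ)} (h : f ⊆ g) : dom f ⊆ dom g :=
  fun _ ⟨m, hm⟩ => ⟨m, h hm⟩

lemma IsCond.lev_eq {f : Set (ℕ × ℕ)} (hf : IsCond ℓ f) (hℓ : ℓ ≠ 1) {i m : ℕ}
    (h : (i, m) ∈ f) : lev ℓ m = lev ℓ i := by
  have key := hf.level_iff hℓ i m h
  by_cases h0 : i = 0
  · by_cases hm : m = 0
    · rw [h0, hm]
    · exact absurd h0 (mem_level_iff.1 ((key _).1 (mem_level_iff.2 ⟨hm, rfl⟩))).1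
  · exact (mem_level_iff.1 ((key _).2 (mem_level_iff.2 ⟨h0, rfl⟩))).2

lemma IsCond.chain_lev {f : Set (ℕ × ℕ)} (hf : IsCond ℓ f) (hℓ : ℓ ≠ 1) {c : ℕ → ℕ}
    (hc : ∀ j < ℓ, (c j, c (j + 1)) ∈ f) : ∀ j ≤ ℓ, lev ℓ (c j) = lev ℓ (c 0)
  | 0, _ => rfl
  | j + 1, hj => (hf.lev_eq hℓ (hc j hj)).trans (hf.chain_lev hℓ hc j (by omega))

/-- The set that agrees with `y n` on the `n`-th interval. -/
def mixGraph (y : ℕ → Cond ℓ) : Set (ℕ × ℕ) := {x | x ∈ (y (lev ℓ x.1)).graph}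

/-- For `ℓ ≠ 1` a value lies in the same interval as its argument, so collisions and cycles never
involve two different `y n`. Only the growth clause needs a hypothesis. -/
lemma isCond_mixGraph (y : ℕ → Cond ℓ)
    (hy : ∀ m : ℕ, ∃ᶠ n in atTop, m ≤ (level ℓ n \ dom (y n).graph).ncard) :
    IsCond ℓ (mixGraph y) where
  isFun i a b ha hb := (y (lev ℓ i)).2.isFun i a b ha hb
  growth m := (hy m).mono fun n hn => by
    convert hn using 2
    ext i
    simp only [Set.mem_sdiff, mem_level_iff]
    refine and_congr_right fun hi => not_congr ?_
    simp [dom, mixGraph, hi.2]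
  two_valued hℓ i m h := (y (lev ℓ i)).2.two_valued hℓ i m h
  injective hℓ i j m hi hj := by
    have h1 := (y (lev ℓ i)).2.lev_eq hℓ hi
    have h2 := (y (lev ℓ j)).2.lev_eq hℓ hj
    have hij : lev ℓ j = lev ℓ i := h2.symm.trans h1
    have hj' : (j, m) ∈ (y (lev ℓ i)).graph := by rw [← hij]; exact hj
    exact (y (lev ℓ i)).2.injective hℓ i j m hi hj'
  level_iff hℓ i m h := (y (lev ℓ i)).2.level_iff hℓ i m h
  cycle hℓ i hi := by
    obtain ⟨m, hm⟩ := hi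
    obtain ⟨c, hc0, hc, hcard⟩ := (y (lev ℓ i)).2.cycle hℓ i ⟨m, hm⟩
    refine ⟨c, hc0, fun j hj => ?_, hcard⟩
    have := (y (lev ℓ i)).2.chain_lev hℓ hc j hj.le
    change (c j, c (j + 1)) ∈ (y (lev ℓ (c j))).graph
    rw [this, hc0]
    exact hc j hj

/-- The condition that agrees with `u` on the intervals up to the `j`-th one and with `f` on the
later ones. -/
def Cond.mix (j : ℕ) (u f : Cond ℓ) : Cond ℓ :=
  ⟨mixGraph fun n => if n ≤ j then u else f, isCond_mixGraph _ fun m => by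
    refine ((f.2.growth m).and_eventually (eventually_gt_atTop j)).mono ?_
    rintro n ⟨h1, h2⟩
    rw [if_neg (not_le.2 h2)]
    exact h1⟩

lemma mem_mix {j : ℕ} {u f : Cond ℓ} {x : ℕ × ℕ} :
    x ∈ (Cond.mix j u f).graph ↔
      (lev ℓ x.1 ≤ j ∧ x ∈ u.graph) ∨ (j < lev ℓ x.1 ∧ x ∈ f.graph) := by
  change x ∈ (if lev ℓ x.1 ≤ j then u else f).graph ↔ _
  split_ifs with h
  · simp [h]
  · simp [h, not_le.1 h]

lemma Cond.ext_graph {f g : Cond ℓ} (h : f.graph = g.graph) : f = g := Subtype.ext h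

/-- The part of a condition on the intervals up to the `j`-th one. -/
def low (j : ℕ) (f : Cond ℓ) : Set (ℕ × ℕ) := {x | lev ℓ x.1 ≤ j ∧ x ∈ f.graph}

lemma low_subset_box (j : ℕ) (f : Cond ℓ) :
    low j f ⊆ Set.Iio (max ℓ 2 ^ (j + 1)) ×ˢ Set.Iio (max ℓ 2 ^ (j + 1)) := by
  rintro ⟨i, m⟩ ⟨h, hx⟩
  refine ⟨lev_le_iff.1 h, ?_⟩
  change m < _
  by_cases hℓ : ℓ = 1
  · refine (f.2.two_valued hℓ i m hx).trans_le ((le_max_right ℓ 2).trans ?_)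
    exact Nat.le_self_pow (by omega) _
  · rw [← lev_le_iff, f.2.lev_eq hℓ hx]
    exact h

lemma low_finite (j : ℕ) (f : Cond ℓ) : (low j f).Finite :=
  ((Set.finite_Iio _).prod (Set.finite_Iio _)).subset (low_subset_box j f)

lemma range_low_finite (j : ℕ) : (Set.range (low (ℓ := ℓ) j)).Finite := by
  have hbox := (Set.finite_Iio (max ℓ 2 ^ (j + 1))).prod (Set.finite_Iio (max ℓ 2 ^ (j + 1)))
  refine hbox.finite_subsets.subset ?_
  rintro _ ⟨f, rfl⟩
  exact low_subset_box j f

/-- No condition properly extends `u` on the intervals up to the `j`-th one. -/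
def Full (j : ℕ) (u : Cond ℓ) : Prop :=
  ∀ v : Cond ℓ, low j u ⊆ v.graph → low j v ⊆ u.graph

/-- Every condition `g` has a finite extension that is full up to the `j`-th interval. -/
lemma exists_full (j : ℕ) (g : Cond ℓ) :
    ∃ u : Cond ℓ, g.graph ⊆ u.graph ∧ Cond.mix j u g = u ∧ Full j u := by
  -- Maximality makes sense because only finitely many initial parts exist.
  obtain ⟨s, ⟨⟨v, hgv, rfl⟩, hmax⟩⟩ :=
    Set.Finite.exists_maximal (s := {s | ∃ v : Cond ℓ, g.graph ⊆ v.graph ∧ low j v = s})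
      ((range_low_finite (ℓ := ℓ) j).subset fun s ⟨v, _, hv⟩ => ⟨v, hv⟩)
      ⟨_, g, subset_rfl, rfl⟩
  have hsub : g.graph ⊆ (Cond.mix j v g).graph := fun x hx => by
    rcases le_or_gt (lev ℓ x.1) j with h | h
    · exact mem_mix.2 (Or.inl ⟨h, hgv hx⟩)
    · exact mem_mix.2 (Or.inr ⟨h, hx⟩)
  refine ⟨Cond.mix j v g, hsub, ?_, ?_⟩
  · apply Cond.ext_graph
    ext x
    simp only [mem_mix]
    grind
  · intro w hw x hx
    have hvw : low j v ⊆ w.graph := fun y hy => hw ⟨hy.1, mem_mix.2 (Or.inl hy)⟩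
    have hgw : g.graph ⊆ (Cond.mix j w g).graph := fun y hy => mem_mix.2 <|
      (le_or_gt _ _).imp (fun h => ⟨h, hvw ⟨h, hgv hy⟩⟩) (⟨·, hy⟩)
    exact mem_mix.2 (Or.inl (hmax ⟨_, hgw, rfl⟩
      (fun y hy => ⟨hy.1, mem_mix.2 (Or.inl ⟨hy.1, hvw hy⟩)⟩)
      ⟨hx.1, mem_mix.2 (Or.inl hx)⟩))

/-- If `g` is almost included in `p`, then some finite modification of `p` extends `g`. -/
lemma exists_almostEq_extension {g p : Cond ℓ} (h : AlmostSubset g.graph p.graph) :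
    ∃ r : Cond ℓ, g.graph ⊆ r.graph ∧ AlmostEq r.graph p.graph := by
  obtain ⟨N, hN⟩ : ∃ N, ∀ x ∈ g.graph \ p.graph, lev ℓ x.1 ≤ N := by
    obtain ⟨N, hN⟩ := (h.image fun x => lev ℓ x.1).bddAbove
    exact ⟨N, fun x hx => hN ⟨x, hx, rfl⟩⟩
  refine ⟨Cond.mix N g p, fun x hx => ?_, (low_finite N g).subset ?_, (low_finite N p).subset ?_⟩
  · by_cases hxp : x ∈ p.graph
    · exact mem_mix.2 ((le_or_gt _ _).imp (⟨·, hx⟩) (⟨·, hxp⟩))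
    · exact mem_mix.2 (Or.inl ⟨hN x ⟨hx, hxp⟩, hx⟩)
  · rintro x ⟨h1, h2⟩
    rcases mem_mix.1 h1 with h | h
    · exact h
    · exact absurd h.2 h2
  · rintro x ⟨h1, h2⟩
    refine ⟨not_lt.1 fun h => h2 (mem_mix.2 (Or.inr ⟨h, h1⟩)), h1⟩

/-- Simultaneous fusion: if finitely many monotone requirements can always be met by extending a
condition beyond the `j`-th interval, then all of them can be met for infinitely many `j`. -/
lemma exists_fusion {X : Type} (T : ℕ → Set X) (hT : ∀ j, (T j).Finite)
    (R : ℕ → X → Cond ℓ → Prop)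
    (f : Cond ℓ)
    (hmono : ∀ j x (g g' : Cond ℓ), g.graph ⊆ g'.graph → R j x g → R j x g')
    (hdense : ∀ j x (g : Cond ℓ), f.graph ⊆ g.graph →
      ∃ g', g.graph ⊆ g'.graph ∧ low j g' = low j g ∧ R j x g') :
    ∃ f' : Cond ℓ, f.graph ⊆ f'.graph ∧ ∃ a : ℕ → ℕ, StrictMono a ∧
      ∀ k, ∀ x ∈ T (a k), R (a k) x f' := by
  have hfin : ∀ j (S : Set X), S.Finite → ∀ g : Cond ℓ, f.graph ⊆ g.graph →
      ∃ g', g.graph ⊆ g'.graph ∧ low j g' = low j g ∧ ∀ x ∈ S, R j x g' := by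
    intro j S hS
    induction S, hS using Set.Finite.induction_on with
    | empty => exact fun g _ => ⟨g, subset_rfl, rfl, by simp⟩
    | @insert x S _ _ ih =>
      intro g hg
      obtain ⟨g₁, h1, h2, h3⟩ := ih g hg
      obtain ⟨g₂, h4, h5, h6⟩ := hdense j x g₁ (hg.trans h1)
      refine ⟨g₂, h1.trans h4, h5.trans h2, fun z hz => ?_⟩
      rcases hz with rfl | hz
      · exact h6
      · exact hmono j z g₁ g₂ h4 (h3 z hz)
  have hstep : ∀ (k : ℕ) (s : {g : Cond ℓ // f.graph ⊆ g.graph} × ℕ),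
      ∃ s' : {g : Cond ℓ // f.graph ⊆ g.graph} × ℕ, s.2 < s'.2 ∧
        s.1.1.graph ⊆ s'.1.1.graph ∧ low s'.2 s'.1.1 = low s'.2 s.1.1 ∧
        k ≤ (level ℓ s'.2 \ dom s.1.1.graph).ncard ∧ ∀ x ∈ T s'.2, R s'.2 x s'.1.1 := by
    rintro k ⟨⟨g, hg⟩, N⟩
    -- The interval of the new boundary still misses `k` points. Everything up to it is frozen from
    -- now on, so these gaps survive in the limit.
    obtain ⟨j, hj, hNj⟩ := ((g.2.growth k).and_eventually (eventually_gt_atTop N)).exists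
    obtain ⟨g', h1, h2, h3⟩ := hfin j (T j) (hT j) g hg
    exact ⟨⟨⟨g', hg.trans h1⟩, j⟩, hNj, h1, h2, hj, h3⟩
  choose F hF using hstep
  let s : ℕ → {g : Cond ℓ // f.graph ⊆ g.graph} × ℕ := fun k =>
    Nat.rec (⟨f, subset_rfl⟩, 0) (fun k s => F k s) k
  have hs : ∀ k, (s k).2 < (s (k + 1)).2 ∧
        (s k).1.1.graph ⊆ (s (k + 1)).1.1.graph ∧
        low (s (k + 1)).2 (s (k + 1)).1.1 = low (s (k + 1)).2 (s k).1.1 ∧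
        k ≤ (level ℓ (s (k + 1)).2 \ dom (s k).1.1.graph).ncard ∧
        ∀ x ∈ T (s (k + 1)).2, R (s (k + 1)).2 x (s (k + 1)).1.1 := fun k => hF k (s k)
  have hjmono : StrictMono fun k => (s k).2 := strictMono_nat_of_lt_succ fun k => (hs k).1
  have hgmono : Monotone fun k => (s k).1.1.graph := monotone_nat_of_le_succ fun k => (hs k).2.1
  have hlow : ∀ k m, k ≤ m → ∀ x : ℕ × ℕ, lev ℓ x.1 ≤ (s (k + 1)).2 →
      (x ∈ (s m).1.1.graph ↔ x ∈ (s k).1.1.graph) := by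
    intro k m hkm
    induction m, hkm using Nat.le_induction with
    | base => exact fun _ _ => Iff.rfl
    | succ m hkm ih =>
      intro x hx
      have hx' : lev ℓ x.1 ≤ (s (m + 1)).2 := le_trans hx (hjmono.monotone (Nat.succ_le_succ hkm))
      have := Set.ext_iff.1 (hs m).2.2.1 x
      simp only [low, Set.mem_ofPred_eq, hx', true_and] at this
      rw [this, ih x hx]
  have hmix : ∀ k (x : ℕ × ℕ), lev ℓ x.1 ≤ (s (k + 1)).2 →
      (x ∈ (s (lev ℓ x.1)).1.1.graph ↔ x ∈ (s k).1.1.graph) := by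
    intro k x hx
    rcases le_total k (lev ℓ x.1) with h | h
    · exact hlow k _ h x hx
    · exact (hlow _ _ h x ((hjmono.le_apply).trans (hjmono.monotone (Nat.le_succ _)))).symm
  -- Boundaries grow at least as fast as stages, so the `n`-th interval is frozen from stage `n` on
  -- and the limit can be read off diagonally.
  let f' : Cond ℓ := ⟨mixGraph fun n => (s n).1.1, isCond_mixGraph _ fun m => by
    rw [frequently_atTop]
    intro N
    refine ⟨(s (max m N + 1)).2, ?_, ?_⟩
    · exact (le_max_right m N).trans ((Nat.le_succ _).trans hjmono.le_apply)
    · refine (le_max_left m N).trans ((hs (max m N)).2.2.2.1.trans_eq ?_)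
      congr 1
      ext i
      simp only [Set.mem_sdiff, mem_level_iff]
      refine and_congr_right fun hi => not_congr (exists_congr fun a => ?_)
      rw [← hmix (max m N) (i, a) hi.2.le, hi.2]⟩
  have hsub : ∀ k, (s k).1.1.graph ⊆ f'.graph := by
    intro k x hx
    rcases le_total (lev ℓ x.1) (s (k + 1)).2 with h | h
    · exact (hmix k x h).2 hx
    · exact hgmono ((hjmono.le_apply.trans' (Nat.le_succ k)).trans h) hx
  refine ⟨f', hsub 0, fun k => (s (k + 1)).2, fun a b h => hjmono (Nat.succ_lt_succ h), fun k x hx => ?_⟩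
  exact hmono _ _ _ _ (hsub (k + 1)) ((hs k).2.2.2.2 x hx)

end Mixing

/-! ### Enlarging the domain of a condition by whole cycles. -/

section Extension

variable {ℓ : ℕ}

/-- The cycles of a condition have the exact period `ℓ`. -/
lemma IsCond.cycle_closed {f : Set (ℕ × ℕ)} (hf : IsCond ℓ f) (hℓ : ℓ ≠ 1) {c : ℕ → ℕ}
    (hc : ∀ j < ℓ, (c j, c (j + 1)) ∈ f)
    (hcard : ((Finset.range (ℓ + 1)).image c).card = ℓ) :
    c ℓ = c 0 ∧ ((Finset.range ℓ).image c).card = ℓ := by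
  have hni : ¬ Set.InjOn c (Finset.range (ℓ + 1)) := fun hinj => by
    rw [Finset.card_image_of_injOn hinj, Finset.card_range] at hcard
    omega
  have hex : ∃ a d, 0 < d ∧ a + d ≤ ℓ ∧ c a = c (a + d) := by
    simp only [Set.InjOn, Finset.coe_range, Set.mem_Iio, not_forall] at hni
    obtain ⟨a, ha, b, hb, hab, hne⟩ := hni
    rcases lt_or_gt_of_ne hne with h | h
    · exact ⟨a, b - a, by omega, by omega, by rw [hab]; congr 1; omega⟩
    · exact ⟨b, a - b, by omega, by omega, by rw [← hab]; congr 1; omega⟩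
  obtain ⟨a, d, hd, had, hcd⟩ := hex
  -- Injectivity pulls a repetition back to the start; single-valuedness then spreads the period `d`
  -- forward, leaving at most `d` values, whence `d = ℓ`.
  have hdown : ∀ a, a + d ≤ ℓ → c a = c (a + d) → c 0 = c d := by
    intro a
    induction a with
    | zero => intro _ h; simpa using h
    | succ a ih =>
      intro h1 h2
      refine ih (by omega) (hf.injective hℓ _ _ _ (hc a (by omega)) ?_)
      rw [h2, Nat.succ_add]
      exact hc (a + d) (by omega)
  have h0 := hdown a had hcd
  have hup : ∀ k, k + d ≤ ℓ → c (k + d) = c k := by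
    intro k
    induction k with
    | zero => intro _; simpa using h0.symm
    | succ k ih =>
      intro h
      refine hf.isFun (c k) _ _ ?_ (hc k (by omega))
      rw [← ih (by omega), Nat.succ_add]
      exact hc (k + d) (by omega)
  have hsub : (Finset.range (ℓ + 1)).image c ⊆ (Finset.range d).image c := by
    have : ∀ k ≤ ℓ, c k ∈ (Finset.range d).image c := by
      intro k
      induction k using Nat.strong_induction_on with
      | _ k ih =>
        intro hk
        by_cases hkd : k < d
        · exact Finset.mem_image_of_mem c (Finset.mem_range.2 hkd)
        · have := hup (k - d) (by omega)
          rw [Nat.sub_add_cancel (by omega)] at this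
          rw [this]
          exact ih (k - d) (by omega) (by omega)
    intro x hx
    obtain ⟨k, hk, rfl⟩ := Finset.mem_image.1 hx
    exact this k (by have := Finset.mem_range.1 hk; omega)
  have h1 := (Finset.card_le_card hsub).trans Finset.card_image_le
  rw [hcard, Finset.card_range] at h1
  obtain rfl : d = ℓ := by omega
  refine ⟨h0.symm, le_antisymm (Finset.card_image_le.trans_eq (Finset.card_range _)) ?_⟩
  calc d = _ := hcard.symm
    _ ≤ _ := Finset.card_le_card hsub

/-- Peel off the cycle through one point: by injectivity nothing outside the cycle is mapped into
it, so the rest of `D` is again closed under `f`. -/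
lemma IsCond.dvd_card {f : Set (ℕ × ℕ)} (hf : IsCond ℓ f) (hℓ : ℓ ≠ 1) (h0 : 1 ≤ ℓ)
    (D : Finset ℕ) (hD : ∀ i ∈ D, i ∈ dom f)
    (hcl : ∀ i ∈ D, ∀ m, (i, m) ∈ f → m ∈ D) : ℓ ∣ D.card := by
  induction D using Finset.strongInduction with
  | _ D ih =>
    rcases D.eq_empty_or_nonempty with rfl | ⟨i, hi⟩
    · simp
    obtain ⟨c, hc0, hc, hcard⟩ := hf.cycle hℓ i (hD i hi)
    obtain ⟨hcl0, hcardO⟩ := hf.cycle_closed hℓ hc hcard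
    set O := (Finset.range ℓ).image c with hO
    have hcD : ∀ j ≤ ℓ, c j ∈ D := by
      intro j
      induction j with
      | zero => intro _; rwa [hc0]
      | succ j ihj => exact fun hj => hcl _ (ihj (by omega)) _ (hc j (by omega))
    have hOD : O ⊆ D := by
      intro x hx
      obtain ⟨k, hk, rfl⟩ := Finset.mem_image.1 hx
      exact hcD k (Finset.mem_range.1 hk).le
    have hcO : ∀ j < ℓ, c j ∈ O := fun j hj => Finset.mem_image_of_mem c (Finset.mem_range.2 hj)
    have hiO : i ∈ O := hc0 ▸ hcO 0 (by omega)
    have hsum := Finset.card_sdiff_add_card_eq_card hOD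
    rw [← hsum]
    refine dvd_add (ih _ ?_ (fun x hx => hD x (Finset.mem_sdiff.1 hx).1) ?_) (by rw [hcardO])
    · exact Finset.ssubset_iff_subset_ne.2 ⟨Finset.sdiff_subset, fun e => by
        rw [← e] at hi
        exact (Finset.mem_sdiff.1 hi).2 hiO⟩
    · intro x hx m hm
      obtain ⟨hxD, hxO⟩ := Finset.mem_sdiff.1 hx
      refine Finset.mem_sdiff.2 ⟨hcl x hxD m hm, fun hmO => hxO ?_⟩
      obtain ⟨k, hk, rfl⟩ := Finset.mem_image.1 hmO
      have hk := Finset.mem_range.1 hk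
      rcases k with _ | k
      · have h1 := hc (ℓ - 1) (by omega)
        rw [Nat.sub_add_cancel h0, hcl0] at h1
        rw [hf.injective hℓ _ _ _ hm h1]
        exact hcO _ (by omega)
      · rw [hf.injective hℓ _ _ _ hm (hc k (by omega))]
        exact hcO _ (by omega)

/-- Adding points in a single interval keeps the growth clause. -/
lemma IsCond.growth_of_level {f g : Set (ℕ × ℕ)} (hf : IsCond ℓ f) (n : ℕ)
    (hg : ∀ x ∈ g, x ∈ f ∨ lev ℓ x.1 = n) (m : ℕ) :
    ∃ᶠ k in atTop, m ≤ (level ℓ k \ dom g).ncard := by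
  refine ((hf.growth m).and_eventually (eventually_gt_atTop n)).mono ?_
  rintro k ⟨h1, h2⟩
  refine h1.trans (Set.ncard_le_ncard ?_ ((level_finite ℓ k).subset Set.sdiff_subset))
  rintro i ⟨hi, hif⟩
  refine ⟨hi, fun ⟨a, ha⟩ => ?_⟩
  rcases hg _ ha with h | h
  · exact hif ⟨a, h⟩
  · exact absurd ((mem_level_iff.1 hi).2.symm.trans h) (by omega)

/-- Adding to a condition a cycle of length `ℓ` in the complement of its domain. -/
lemma IsCond.union_cycle {f : Set (ℕ × ℕ)} (hf : IsCond ℓ f) (hℓ : 2 ≤ ℓ) {n : ℕ}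
    (e : Fin ℓ → ℕ) (he : Function.Injective e) (hn : ∀ a, e a ∈ level ℓ n)
    (hef : ∀ a, e a ∉ dom f) :
    IsCond ℓ (f ∪ {x | ∃ a, x = (e a, e (finRotate ℓ a))}) := by
  have hℓ1 : ℓ ≠ 1 := by omega
  have hrange : ∀ i m, (i, m) ∈ f → m ∈ dom f := by
    intro i m him
    obtain ⟨c, hc0, hc, -⟩ := hf.cycle hℓ1 i ⟨m, him⟩
    have h1 := hc 0 (by omega)
    rw [hc0] at h1
    rw [hf.isFun _ _ _ him h1]
    exact ⟨_, hc 1 (by omega)⟩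
  refine ⟨?_, ?_, fun h => absurd h hℓ1, fun _ => ?_, fun _ => ?_, fun _ => ?_⟩
  · rintro i a b (ha | ⟨x, hx⟩) (hb | ⟨y, hy⟩)
    · exact hf.isFun i a b ha hb
    · rw [Prod.mk.injEq] at hy
      exact absurd ⟨a, hy.1 ▸ ha⟩ (hef y)
    · rw [Prod.mk.injEq] at hx
      exact absurd ⟨b, hx.1 ▸ hb⟩ (hef x)
    · rw [Prod.mk.injEq] at hx hy
      rw [hx.2, hy.2, he (hx.1.symm.trans hy.1)]
  · refine hf.growth_of_level n ?_
    rintro x (hx | ⟨a, rfl⟩)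
    · exact Or.inl hx
    · exact Or.inr (mem_level_iff.1 (hn a)).2
  · rintro i j m (hi | ⟨x, hx⟩) (hj | ⟨y, hy⟩)
    · exact hf.injective hℓ1 i j m hi hj
    · rw [Prod.mk.injEq] at hy
      exact absurd (hy.2 ▸ hrange i m hi) (hef _)
    · rw [Prod.mk.injEq] at hx
      exact absurd (hx.2 ▸ hrange j m hj) (hef _)
    · rw [Prod.mk.injEq] at hx hy
      rw [hx.1, hy.1, (finRotate ℓ).injective (he (hx.2.symm.trans hy.2))]
  · rintro i m (hi | ⟨x, hx⟩) k
    · exact hf.level_iff hℓ1 i m hi k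
    · rw [Prod.mk.injEq] at hx
      obtain ⟨rfl, rfl⟩ := hx
      have h1 := mem_level_iff.1 (hn x)
      have h2 := mem_level_iff.1 (hn (finRotate ℓ x))
      rw [mem_level_iff, mem_level_iff, h1.2, h2.2]
      exact and_congr_left fun _ => iff_of_true h2.1 h1.1
  · rintro i ⟨m, hi | ⟨x, hx⟩⟩
    · obtain ⟨c, hc0, hc, hcard⟩ := hf.cycle hℓ1 i ⟨m, hi⟩
      exact ⟨c, hc0, fun j hj => Or.inl (hc j hj), hcard⟩
    · rw [Prod.mk.injEq] at hx
      obtain ⟨rfl, rfl⟩ := hx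
      have : NeZero ℓ := ⟨by omega⟩
      refine ⟨fun j => e (x + Fin.ofNat ℓ j), ?_, fun j _ => Or.inr ⟨x + Fin.ofNat ℓ j, ?_⟩, ?_⟩
      · simp
      · rw [finRotate_apply, add_assoc]
        have : Fin.ofNat ℓ (j + 1) = Fin.ofNat ℓ j + 1 := by
          apply Fin.ext
          simp [Fin.val_add]
        rw [← this]
      · have : (Finset.range (ℓ + 1)).image (fun j => e (x + Fin.ofNat ℓ j))
            = Finset.univ.image e := by
          ext y
          simp only [Finset.mem_image, Finset.mem_range, Finset.mem_univ, true_and]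
          constructor
          · rintro ⟨j, -, rfl⟩
            exact ⟨_, rfl⟩
          · rintro ⟨a, rfl⟩
            refine ⟨(a - x).val, by omega, ?_⟩
            simp
        rw [this, Finset.card_image_of_injective _ he, Finset.card_univ, Fintype.card_fin]

/-- Every point beyond the first interval can be added to the domain of a condition. -/
lemma exists_mem_dom (hℓ : 1 ≤ ℓ) (f : Cond ℓ) {i : ℕ} (hi : 0 < lev ℓ i) :
    ∃ g : Cond ℓ, f.graph ⊆ g.graph ∧ i ∈ dom g.graph := by
  by_cases hif : i ∈ dom f.graph
  · exact ⟨f, subset_rfl, hif⟩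
  have hi0 : i ≠ 0 := by
    rintro rfl
    simp [lev] at hi
  by_cases h1 : ℓ = 1
  · have hg : ∀ x ∈ f.graph ∪ {(i, 0)}, x ∈ f.graph ∨ lev ℓ x.1 = lev ℓ i := by
      rintro x (hx | rfl)
      · exact Or.inl hx
      · exact Or.inr rfl
    refine ⟨⟨f.graph ∪ {(i, 0)}, ?_, f.2.growth_of_level _ hg, ?_, fun h => absurd h1 h,
      fun h => absurd h1 h, fun h => absurd h1 h⟩, Set.subset_union_left, ⟨0, Or.inr rfl⟩⟩
    · rintro j a b (ha | ha) (hb | hb)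
      · exact f.2.isFun j a b ha hb
      · rw [Set.mem_singleton_iff, Prod.mk.injEq] at hb
        exact absurd ⟨a, hb.1 ▸ ha⟩ hif
      · rw [Set.mem_singleton_iff, Prod.mk.injEq] at ha
        exact absurd ⟨b, ha.1 ▸ hb⟩ hif
      · rw [Set.mem_singleton_iff, Prod.mk.injEq] at ha hb
        rw [ha.2, hb.2]
    · rintro _ j m (h | h)
      · exact f.2.two_valued h1 j m h
      · rw [Set.mem_singleton_iff, Prod.mk.injEq] at h
        omega
  set n := lev ℓ i with hn
  have hfin : (level ℓ n \ dom f.graph).Finite := (level_finite ℓ n).subset Set.sdiff_subset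
  classical
  have himem : i ∈ hfin.toFinset := hfin.mem_toFinset.2 ⟨mem_level_iff.2 ⟨hi0, rfl⟩, hif⟩
  have hdvd : ℓ ∣ hfin.toFinset.card := by
    have hD : (level ℓ n ∩ dom f.graph).Finite :=
      (level_finite ℓ n).subset Set.inter_subset_left
    have hd1 : ℓ ∣ hD.toFinset.card := by
      refine f.2.dvd_card h1 hℓ _ (fun j hj => (hD.mem_toFinset.1 hj).2) fun j hj m hm => ?_
      have hj := hD.mem_toFinset.1 hj
      refine hD.mem_toFinset.2 ⟨(f.2.level_iff h1 j m hm n).2 hj.1, ?_⟩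
      obtain ⟨c, hc0, hc, -⟩ := f.2.cycle h1 j ⟨m, hm⟩
      have h2 := hc 0 (by omega)
      rw [hc0] at h2
      rw [f.2.isFun _ _ _ hm h2]
      exact ⟨_, hc 1 (by omega)⟩
    have hsum : hfin.toFinset.card + hD.toFinset.card = max ℓ 2 ^ (n + 1) - max ℓ 2 ^ n := by
      rw [← Set.ncard_eq_toFinset_card _ hfin, ← Set.ncard_eq_toFinset_card _ hD, add_comm,
        Set.ncard_inter_add_ncard_sdiff_eq_ncard _ _ (level_finite ℓ n), level,
        ← Finset.coe_Ico, Set.ncard_coe_finset, Nat.card_Ico]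
    -- This needs `n ≠ 0`: the interval of index 0 has `ℓ - 1` points and admits no cycle.
    have hdtot : ℓ ∣ max ℓ 2 ^ (n + 1) - max ℓ 2 ^ n := by
      rw [max_eq_left (by omega)]
      exact Nat.dvd_sub (dvd_pow_self _ (by omega)) (dvd_pow_self _ (by omega))
    rw [← hsum] at hdtot
    exact (Nat.dvd_add_left hd1).1 hdtot
  obtain ⟨S, hiS, hSM, hScard⟩ := Finset.exists_subsuperset_card_eq
    (Finset.singleton_subset_iff.2 himem) (by simpa using hℓ)
    (Nat.le_of_dvd (Finset.card_pos.2 ⟨i, himem⟩) hdvd)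
  let e := S.equivFinOfCardEq hScard
  have hS : ∀ a, ((e.symm a : S) : ℕ) ∈ level ℓ n \ dom f.graph := fun a =>
    hfin.mem_toFinset.1 (hSM (e.symm a).2)
  refine ⟨⟨_, f.2.union_cycle (by omega) (fun a => ((e.symm a : S) : ℕ))
    (Subtype.val_injective.comp e.symm.injective) (fun a => (hS a).1) (fun a => (hS a).2)⟩,
    Set.subset_union_left, ?_⟩
  refine ⟨e.symm (finRotate ℓ (e ⟨i, Finset.singleton_subset_iff.1 hiS⟩)),
    Or.inr ⟨e ⟨i, Finset.singleton_subset_iff.1 hiS⟩, ?_⟩⟩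
  rw [Equiv.symm_apply_apply]

end Extension

/-! ### Reducing the two-step forcing relation to single conditions. -/

section ForcingRelation

variable {ℓ : ℕ}

lemma le_of_subset {p q : Cond ℓ} (h : q.graph ⊆ p.graph) : p ≤ q := by
  change (q.graph \ p.graph).Finite
  rw [Set.sdiff_eq_empty.2 h]
  exact Set.finite_empty

lemma fEx_mono {P X : Type} [Preorder P] {φ : X → Stmt P} {p q : P} (hqp : q ≤ p)
    (h : fEx φ p) : fEx φ q := fun r hr => h r (hr.trans hqp)

lemma inGeneric_of_le {f q : Cond ℓ} (h : q ≤ f) : inGeneric f q :=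
  fun r hr => ⟨r, le_rfl, f, rfl, hr.trans h⟩

lemma inPF_of_le {g q : Cond ℓ} (h : q ≤ g) : inPF g q :=
  fun r hr => ⟨r, le_rfl, g, inGeneric_of_le (hr.trans h), by
    simp [ground, AlmostEq, AlmostSubset]⟩

lemma inPF_mono {g p q : Cond ℓ} (hqp : q ≤ p) (h : inPF g p) : inPF g q := fEx_mono hqp h

/-- Some condition below `q` almost contains `g`. A finite change makes it contain `g` and does not
affect its place in the order of `P_ℓ`. -/
lemma exists_diagonal {g q : Cond ℓ} (h : inPF g q) : ∃ r ≤ q, g.graph ⊆ r.graph := by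
  obtain ⟨r, hr, f, hf, hgf⟩ := h q le_rfl
  obtain ⟨r', hr', f', hff', hr'f⟩ := hf r le_rfl
  obtain rfl : f = f' := hff'
  have hle : r' ≤ g := hr'f.trans (show f ≤ g from hgf.1)
  obtain ⟨s, hgs, hs⟩ := exists_almostEq_extension hle
  exact ⟨s, (show s ≤ r' from hs.2).trans (hr'.trans hr), hgs⟩

variable {h : RelName ℓ}

lemma qVal_mono {i m : ℕ} {g g' p p' : Cond ℓ} (hg : g.graph ⊆ g'.graph) (hp : p' ≤ p)
    (hv : qVal h i m g p) : qVal h i m g' p' :=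
  fun g₁ q hq hg₁ q' hq' hsub => hv g₁ q (hq.trans hp) hg₁ q' hq' (hg.trans hsub)

/-- A value that is forced densely is forced. -/
lemma qVal_of_dense {i m : ℕ} {g p : Cond ℓ}
    (hd : ∀ g' : Cond ℓ, g.graph ⊆ g'.graph → g' ≤ p →
      ∃ g'' : Cond ℓ, g'.graph ⊆ g''.graph ∧ qVal h i m g'' g'') : qVal h i m g p := by
  intro g₁ q hq hg₁ q' hq' hsub q₂ hq₂
  obtain ⟨g', hg'q, hg'⟩ := exists_diagonal (inPF_mono (hq₂.trans hq') hg₁)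
  obtain ⟨g'', hg'', hv⟩ := hd g' (hsub.trans hg') (hg'q.trans (hq₂.trans (hq'.trans hq)))
  obtain ⟨r, hr, g₂, hg₂, hsub₂, hex⟩ :=
    hv g'' g'' le_rfl (inPF_of_le le_rfl) g'' le_rfl subset_rfl g'' le_rfl
  exact ⟨r, hr.trans ((le_of_subset hg'').trans hg'q), g₂, hg₂,
    hg'.trans (hg''.trans hsub₂), hex⟩

lemma exists_val {p g : Cond ℓ} (hF : isFunctionName h p) (hg : g ≤ p) (i : ℕ) :
    ∃ g' : Cond ℓ, g.graph ⊆ g'.graph ∧ ∃ m, qVal h i m g' g' := by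
  have hF' := (hF g g hg (inPF_of_le le_rfl)).1 i
  obtain ⟨r, hr, g₂, hg₂, hsub, hex⟩ :=
    hF' g g le_rfl (inPF_of_le le_rfl) g le_rfl subset_rfl g le_rfl
  obtain ⟨r', hr', m, hm⟩ := hex r le_rfl
  obtain ⟨g', hg'r, hg'⟩ := exists_diagonal (inPF_mono hr' hg₂)
  exact ⟨g', hsub.trans hg', m, qVal_mono hg' hg'r hm⟩

lemma val_unique {p q g : Cond ℓ} (hF : isFunctionName h p) (hq : q ≤ p) (hg : inPF g q)
    {i m m' : ℕ} (hm : qVal h i m g q) (hm' : qVal h i m' g q) : m = m' := by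
  by_contra hne
  exact (hF g q hq hg).2 i m ⟨m', fun e => hne e.symm⟩ g q le_rfl hg q le_rfl subset_rfl q le_rfl
    ⟨hm, hm'⟩

/-- If no extension of `f` decides `h` on `dom f`, then `f` forces the restriction to be new. -/
lemma restrictionIsNew_of_undecided {f : Cond ℓ}
    (hf : ¬ ∃ g : Cond ℓ, f.graph ⊆ g.graph ∧ ∃ a : ℕ → ℕ, ∀ i ∈ dom f.graph,
      qVal h i (a i) g g) : restrictionIsNew h f := by
  intro q hq
  refine ⟨q, le_rfl, f, inGeneric_of_le hq, ?_⟩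
  intro g₁ q₁ _ hg₁ q₂ hq₂ hsub q₃ hq₃ hR
  have hg₁' := inPF_mono (hq₃.trans hq₂) hg₁
  obtain ⟨r, hr, g₂, hg₂, hsub₂, hex⟩ :=
    hR g₁ q₃ le_rfl hg₁' q₃ le_rfl subset_rfl q₃ le_rfl
  obtain ⟨r', hr', a, ha⟩ := hex r le_rfl
  obtain ⟨g', hg'r, hg'⟩ := exists_diagonal (inPF_mono hr' hg₂)
  exact hf ⟨g', hsub.trans (hsub₂.trans hg'), a, fun i hi => qVal_mono hg' hg'r (ha ⟨i, hi⟩)⟩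

end ForcingRelation

/-! ### Splitting, stability and decision by blocks. -/

section Blocks

variable {ℓ : ℕ} {h : RelName ℓ}

lemma mix_le (j : ℕ) (u f : Cond ℓ) : Cond.mix j u f ≤ f :=
  (low_finite j f).subset fun _ hx => ⟨not_lt.1 fun hlt => hx.2 (mem_mix.2 (Or.inr ⟨hlt, hx.1⟩)),
    hx.1⟩

lemma le_mix (j : ℕ) (u f : Cond ℓ) : f ≤ Cond.mix j u f :=
  (low_finite j u).subset fun _ hx => by
    rcases mem_mix.1 hx.1 with h | h
    · exact h
    · exact absurd h.2 hx.2

lemma mix_subset_mix {j : ℕ} {u u' f f' : Cond ℓ} (hu : low j u ⊆ u'.graph)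
    (hf : f.graph ⊆ f'.graph) : (Cond.mix j u f).graph ⊆ (Cond.mix j u' f').graph := fun _ hx =>
  mem_mix.2 ((mem_mix.1 hx).imp (fun hx => ⟨hx.1, hu hx⟩) fun hx => ⟨hx.1, hf hx.2⟩)

/-- Every full condition whose part up to the `j`-th interval is `s` decides `h i` when continued
by `f`. -/
def DecidesFull (h : RelName ℓ) (j i : ℕ) (s : Set (ℕ × ℕ)) (f : Cond ℓ) : Prop :=
  ∀ u : Cond ℓ, low j u = s → Full j u →
    ∃ m, qVal h i m (Cond.mix j u f) (Cond.mix j u f)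

/-- Two extensions of `s` up to the `j`-th interval, both continued by `f`, force different values
of `h i`. -/
def Splits (h : RelName ℓ) (j i : ℕ) (s : Set (ℕ × ℕ)) (f : Cond ℓ) : Prop :=
  ∃ u u' : Cond ℓ, s ⊆ u.graph ∧ s ⊆ u'.graph ∧ ∃ m m', m ≠ m' ∧
    qVal h i m (Cond.mix j u f) (Cond.mix j u f) ∧ qVal h i m' (Cond.mix j u' f) (Cond.mix j u' f)

/-- Either a splitting is present on `dom f`, or there is none beyond the `j`-th interval for the
extensions of `f`. -/
def SplitsOrStable (h : RelName ℓ) (j : ℕ) (s : Set (ℕ × ℕ)) (f : Cond ℓ) : Prop :=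
  (∃ i ∈ dom f.graph, Splits h j i s f) ∨
    ∀ f' : Cond ℓ, f.graph ⊆ f'.graph → ∀ i, j < lev ℓ i → ¬ Splits h j i s f'

lemma DecidesFull.mono {j i : ℕ} {s : Set (ℕ × ℕ)} {f f' : Cond ℓ} (hf : f.graph ⊆ f'.graph)
    (hd : DecidesFull h j i s f) : DecidesFull h j i s f' := fun u hu hfull => by
  obtain ⟨m, hm⟩ := hd u hu hfull
  have hsub := mix_subset_mix (fun x (hx : x ∈ low j u) => hx.2) hf
  exact ⟨m, qVal_mono hsub (le_of_subset hsub) hm⟩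

lemma Splits.mono {j i : ℕ} {s : Set (ℕ × ℕ)} {f f' : Cond ℓ}
    (hf : ∀ x ∈ f.graph, j < lev ℓ x.1 → x ∈ f'.graph)
    (hs : Splits h j i s f) : Splits h j i s f' := by
  obtain ⟨u, u', hu, hu', m, m', hne, hm, hm'⟩ := hs
  have hsub : ∀ v : Cond ℓ, (Cond.mix j v f).graph ⊆ (Cond.mix j v f').graph := fun v x hx =>
    mem_mix.2 ((mem_mix.1 hx).imp id fun hx => ⟨hx.1, hf x hx.2 hx.1⟩)
  exact ⟨u, u', hu, hu', m, m', hne, qVal_mono (hsub u) (le_of_subset (hsub u)) hm,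
    qVal_mono (hsub u') (le_of_subset (hsub u')) hm'⟩

lemma SplitsOrStable.mono {j : ℕ} {s : Set (ℕ × ℕ)} {f f' : Cond ℓ} (hf : f.graph ⊆ f'.graph)
    (hs : SplitsOrStable h j s f) : SplitsOrStable h j s f' :=
  hs.imp (fun ⟨i, hi, hsp⟩ => ⟨i, dom_mono hf hi, hsp.mono fun _ hx _ => hf hx⟩)
    fun hst f'' hf'' => hst f'' (hf.trans hf'')

/-- Extend `u`, continued by `g`, to decide `h i`. Fullness prevents anything new up to `j`, so the
decision is due to the part beyond `j`, which can be grafted onto `g`. -/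
lemma exists_decidesFull {p g : Cond ℓ} (hF : isFunctionName h p) (hg : g ≤ p) (j i : ℕ)
    (s : Set (ℕ × ℕ)) :
    ∃ g' : Cond ℓ, g.graph ⊆ g'.graph ∧ low j g' = low j g ∧ DecidesFull h j i s g' := by
  by_cases hu : ∃ u : Cond ℓ, low j u = s ∧ Full j u
  · obtain ⟨u, rfl, hfull⟩ := hu
    obtain ⟨g₁, hg₁, m, hm⟩ := exists_val hF ((mix_le j u g).trans hg) i
    refine ⟨Cond.mix j g g₁, fun x hx => mem_mix.2 ?_, ?_, fun u' hu' _ => ⟨m, ?_⟩⟩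
    · exact (le_or_gt _ _).imp (⟨·, hx⟩) fun hlt => ⟨hlt, hg₁ (mem_mix.2 (Or.inr ⟨hlt, hx⟩))⟩
    · ext x
      simp only [low, Set.mem_ofPred_eq, mem_mix]
      grind
    · have hlow : low j g₁ ⊆ u.graph :=
        hfull g₁ fun x hx => hg₁ (mem_mix.2 (Or.inl hx))
      have hsub : g₁.graph ⊆ (Cond.mix j u' (Cond.mix j g g₁)).graph := fun x hx => by
        refine mem_mix.2 ((le_or_gt _ _).imp (fun hle => ?_) fun hlt =>
          ⟨hlt, mem_mix.2 (Or.inr ⟨hlt, hx⟩)⟩)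
        have hxu : x ∈ low j u := ⟨hle, hlow ⟨hle, hx⟩⟩
        rwa [← hu'] at hxu
      exact qVal_mono hsub (le_of_subset hsub) hm
  · exact ⟨g, subset_rfl, rfl, fun u h1 h2 => absurd ⟨u, h1, h2⟩ hu⟩

/-- A split depends only on the part of the condition beyond `j`. If one ever occurs at some `i`
there, it is kept and `i` is added to the domain, where it will later contradict the decision of `h`
on the domain. -/
lemma exists_splitsOrStable (hℓ : 1 ≤ ℓ) (g : Cond ℓ) (j : ℕ) (s : Set (ℕ × ℕ)) :
    ∃ g' : Cond ℓ, g.graph ⊆ g'.graph ∧ low j g' = low j g ∧ SplitsOrStable h j s g' := by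
  by_cases hst : ∀ f' : Cond ℓ, g.graph ⊆ f'.graph → ∀ i, j < lev ℓ i → ¬ Splits h j i s f'
  · exact ⟨g, subset_rfl, rfl, Or.inr hst⟩
  · push Not at hst
    obtain ⟨f', hf', i, hi, hs⟩ := hst
    obtain ⟨g₁, hg₁, a, ha⟩ := exists_mem_dom hℓ f' (i := i) (by omega)
    refine ⟨Cond.mix j g g₁, fun x hx => mem_mix.2 ?_, ?_, Or.inl ⟨i, ⟨a, ?_⟩, hs.mono ?_⟩⟩
    · exact (le_or_gt _ _).imp (⟨·, hx⟩) (⟨·, hg₁ (hf' hx)⟩)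
    · ext x
      simp only [low, Set.mem_ofPred_eq, mem_mix]
      grind
    · exact mem_mix.2 (Or.inr ⟨hi, ha⟩)
    · exact fun x hx hlt => mem_mix.2 (Or.inr ⟨hlt, hg₁ hx⟩)

/-- If restrictions to domains can always be decided, then below every condition there is one that
admits a sequence of intervals such that the values of `h` are decided by the full conditions up to
the next member of the sequence and do not depend on the earlier members. -/
lemma exists_stable {p : Cond ℓ} (hℓ : 1 ≤ ℓ) (hF : isFunctionName h p)
    (hdec : ∀ f ≤ p, ∃ g : Cond ℓ, f.graph ⊆ g.graph ∧ ∃ a : ℕ → ℕ, ∀ i ∈ dom f.graph,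
      qVal h i (a i) g g) :
    ∃ f ≤ p, ∃ c : ℕ → ℕ, StrictMono c ∧
      (∀ k i, lev ℓ i ≤ c k → ∀ u : Cond ℓ, Full (c k) u →
        ∃ m, qVal h i m (Cond.mix (c k) u f) (Cond.mix (c k) u f)) ∧
      ∀ k i, c k < lev ℓ i → ∀ f' : Cond ℓ, f.graph ⊆ f'.graph →
        ¬ Splits h (c k) i (low (c k) f) f' := by
  obtain ⟨f, hpf, c, hc, hR⟩ := exists_fusion (ℓ := ℓ) (X := ℕ × Set (ℕ × ℕ))
    -- All initial parts are treated, because that of the final condition `g` is not yet known.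
    (fun j => {i | lev ℓ i ≤ j} ×ˢ Set.range (low (ℓ := ℓ) j))
    (fun j => (((Set.finite_Iio (max ℓ 2 ^ (j + 1))).subset
      fun i hi => lev_le_iff.1 hi).prod (range_low_finite j)))
    (fun j x g => DecidesFull h j x.1 x.2 g ∧ SplitsOrStable h j x.2 g) p
    (fun j x g g' hg hx => ⟨hx.1.mono hg, hx.2.mono hg⟩) (fun j x g hg => by
      obtain ⟨g₁, h1, h2, h3⟩ := exists_decidesFull hF (le_of_subset hg) j x.1 x.2
      obtain ⟨g₂, h4, h5, h6⟩ := exists_splitsOrStable (h := h) hℓ g₁ j x.2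
      exact ⟨g₂, h1.trans h4, h5.trans h2, h3.mono h4, h6⟩)
  obtain ⟨g, hfg, a, ha⟩ := hdec f (le_of_subset hpf)
  refine ⟨g, (le_of_subset hfg).trans (le_of_subset hpf), c, hc, ?_, ?_⟩
  · intro k i hi u hu
    exact ((hR k (i, low (c k) u) ⟨hi, u, rfl⟩).1.mono hfg) u rfl hu
  · intro k i hi f' hf'
    -- The point 0 is a dummy; the second requirement does not mention it.
    rcases (hR k (0, low (c k) g) ⟨by simp [lev], g, rfl⟩).2 with hs | hs
    · obtain ⟨i, hi, u, u', hu, hu', m, m', hne, hm, hm'⟩ := hs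
      -- Any continuation of the initial part of `g` is compatible with `g`, which has already fixed
      -- `h i` as `a i`.
      have key : ∀ (v : Cond ℓ) (n : ℕ), low (c k) g ⊆ v.graph →
          qVal h i n (Cond.mix (c k) v f) (Cond.mix (c k) v f) → n = a i := by
        intro v n hv hn
        have h1 : (Cond.mix (c k) v f).graph ⊆ (Cond.mix (c k) v g).graph :=
          mix_subset_mix (fun x hx => hx.2) hfg
        have h2 : g.graph ⊆ (Cond.mix (c k) v g).graph := fun x hx =>
          mem_mix.2 ((le_or_gt _ _).imp (fun hle => ⟨hle, hv ⟨hle, hx⟩⟩) (⟨·, hx⟩))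
        exact val_unique hF
          ((le_of_subset h2).trans ((le_of_subset hfg).trans (le_of_subset hpf)))
          (inPF_of_le le_rfl) (qVal_mono h1 (le_of_subset h1) hn)
          (qVal_mono h2 (le_of_subset h2) (ha i hi))
      exact absurd ((key u m hu hm).trans (key u' m' hu' hm').symm) hne
    · exact hs f' (hfg.trans hf') i hi

/-- In the situation of `exists_stable` the intervals between consecutive members of the sequence
are blocks that decide the values of `h`. -/
lemma decidedByBlocks_of_stable {p f : Cond ℓ} (hF : isFunctionName h p) (hfp : f ≤ p)
    {c : ℕ → ℕ} (hc : StrictMono c)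
    (hd : ∀ k i, lev ℓ i ≤ c k → ∀ u : Cond ℓ, Full (c k) u →
        ∃ m, qVal h i m (Cond.mix (c k) u f) (Cond.mix (c k) u f))
    (hs : ∀ k i, c k < lev ℓ i → ∀ f' : Cond ℓ, f.graph ⊆ f'.graph →
        ¬ Splits h (c k) i (low (c k) f) f') : decidedByBlocks h f := by
  intro q hq
  -- The exponent `c k + 1` makes the `k`-th block consist of the points `i` with `c k < lev ℓ i ≤ c
  -- (k + 1)`.
  refine ⟨q, le_rfl, f, inGeneric_of_le hq, fun q₁ hq₁ => ⟨q₁, le_rfl,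
    fun k => max ℓ 2 ^ (c k + 1), ?_, ?_⟩⟩
  · exact fun a b hab => Nat.pow_lt_pow_right (one_lt_base ℓ) (Nat.succ_lt_succ (hc hab))
  rintro k ⟨i, hi₁, hi₂⟩ g q₂ hq₂ hg q₃ hq₃ hfg q₄ hq₄ hdec q₅ hq₅
  change f.graph ⊆ g.graph at hfg
  rw [← lt_lev_iff] at hi₁
  rw [← lev_le_iff] at hi₂
  obtain ⟨q₆, hq₆, m, hm⟩ := hdec q₅ hq₅
  have hck : c k < c (k + 1) := hc (Nat.lt_succ_self k)
  have hq₆f : q₆ ≤ f := hq₆.trans (hq₅.trans (hq₄.trans (hq₃.trans (hq₂.trans (hq₁.trans hq)))))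
  have hg₆ : inPF g q₆ := inPF_mono (hq₆.trans (hq₅.trans (hq₄.trans hq₃))) hg
  obtain ⟨q₇, hq₇, hgq₇⟩ := exists_diagonal hg₆
  let d : Cond ℓ := Cond.mix (c k) f (Cond.mix (c (k + 1)) g f)
  have hd_graph : d.graph = f.graph ∪
      restr g.graph (Set.Ico (max ℓ 2 ^ (c k + 1)) (max ℓ 2 ^ (c (k + 1) + 1))) := by
    ext x
    have hfg' := @hfg x
    simp only [d, mem_mix, Set.mem_union, restr, Set.mem_ofPred_eq, Set.mem_Ico, ← lt_lev_iff,
      ← lev_le_iff]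
    grind
  have hfd : f.graph ⊆ d.graph := hd_graph ▸ Set.subset_union_left
  refine ⟨q₆, hq₆, d, inPF_of_le (hq₆f.trans ((le_mix _ _ _).trans (le_mix _ _ _))), hd_graph,
    fun q₈ hq₈ => ⟨q₈, le_rfl, m, qVal_mono subset_rfl hq₈ (qVal_of_dense fun g' hdg' _ => ?_)⟩⟩
  -- The value at `u'` is compared with `m` through `u`, which agrees with `u'` on the block but
  -- follows `g` up to `c k`.
  obtain ⟨u', hg'u', -, hu'⟩ := exists_full (c (k + 1)) g'
  obtain ⟨u, hwu, -, hu⟩ := exists_full (c (k + 1)) (Cond.mix (c k) g u')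
  obtain ⟨m', hm'⟩ := hd (k + 1) i hi₂ u' hu'
  obtain ⟨m'', hm''⟩ := hd (k + 1) i hi₂ u hu
  have hfu' : f.graph ⊆ u'.graph := hfd.trans (hdg'.trans hg'u')
  have hblock : ∀ x : ℕ × ℕ, c k < lev ℓ x.1 → lev ℓ x.1 ≤ c (k + 1) →
      (x ∈ u.graph ↔ x ∈ u'.graph) := by
    refine fun x hx₁ hx₂ => ⟨fun hx => ?_, fun hx => hwu (mem_mix.2 (Or.inr ⟨hx₁, hx⟩))⟩
    -- Gluing `u` on top of `u'` extends `u'` up to `c (k + 1)`, so by fullness `u` has nothing more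
    -- on the block.
    refine hu' (Cond.mix (c k) u' u) (fun y hy => mem_mix.2 ?_)
      ⟨hx₂, mem_mix.2 (Or.inr ⟨hx₁, hx⟩)⟩
    exact (le_or_gt _ _).imp (⟨·, hy.2⟩) fun hlt =>
      ⟨hlt, hwu (mem_mix.2 (Or.inr ⟨hlt, hy.2⟩))⟩
  have hgu : low (c (k + 1)) g ⊆ u.graph := by
    rintro x ⟨hx, hxg⟩
    rcases le_or_gt (lev ℓ x.1) (c k) with hle | hlt
    · exact hwu (mem_mix.2 (Or.inl ⟨hle, hxg⟩))
    · rw [hblock x hlt hx]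
      exact hg'u' (hdg' (mem_mix.2 (Or.inr ⟨hlt, mem_mix.2 (Or.inl ⟨hx, hxg⟩)⟩)))
  have hsub : g.graph ⊆ (Cond.mix (c (k + 1)) u g).graph := fun x hx =>
    mem_mix.2 ((le_or_gt _ _).imp (fun hle => ⟨hle, hgu ⟨hle, hx⟩⟩) (⟨·, hx⟩))
  have hsub' : (Cond.mix (c (k + 1)) u f).graph ⊆ (Cond.mix (c (k + 1)) u g).graph :=
    mix_subset_mix (fun x hx => hx.2) hfg
  have hq₇u : q₇ ≤ Cond.mix (c (k + 1)) u g := (le_of_subset hgq₇).trans (le_mix _ _ _)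
  -- `u` continued by `g` extends both `g` and `u` continued by `f`.
  have hmm'' : m = m'' := val_unique hF (hq₇.trans (hq₆f.trans hfp)) (inPF_of_le hq₇u)
    (qVal_mono hsub hq₇ hm) (qVal_mono hsub' (hq₇u.trans (le_of_subset hsub')) hm'')
  -- Over the common continuation `f'`, different values would be a split beyond `c k`, since `u`
  -- and `u'` both extend the initial part of `f`.
  have hm'm'' : m' = m'' := by
    by_contra hne
    let f' : Cond ℓ := Cond.mix (c (k + 1)) u' f
    have hff' : f.graph ⊆ f'.graph := fun x hx =>
      mem_mix.2 ((le_or_gt _ _).imp (fun hle => ⟨hle, hfu' hx⟩) (⟨·, hx⟩))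
    have h1 : Cond.mix (c k) u' f' = Cond.mix (c (k + 1)) u' f := by
      apply Cond.ext_graph
      ext x
      simp only [f', mem_mix]
      grind
    have h2 : Cond.mix (c k) u f' = Cond.mix (c (k + 1)) u f := by
      apply Cond.ext_graph
      ext x
      have := hblock x
      simp only [f', mem_mix]
      grind
    refine hs k i hi₁ f' hff' ⟨u', u, fun x hx => hfu' hx.2, fun x hx => ?_, m', m'', hne, ?_, ?_⟩
    · exact hgu ⟨hx.1.trans hck.le, hfg hx.2⟩
    · rwa [h1]
    · rwa [h2]
  have hsub₂ : (Cond.mix (c (k + 1)) u' f).graph ⊆ u'.graph := fun x hx =>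
    (mem_mix.1 hx).elim And.right fun hx => hfu' hx.2
  exact ⟨u', hg'u', qVal_mono hsub₂ (le_of_subset hsub₂) (hmm''.trans hm'm''.symm ▸ hm')⟩

end Blocks

end TiePoint

theorem mainTheorem6 (ℓ : ℕ) (hℓ : 1 ≤ ℓ) (h : TiePoint.RelName ℓ) :
    TiePoint.Forced
      (TiePoint.fImp (TiePoint.isFunctionName h)
        (TiePoint.fOr (TiePoint.restrictionIsNew h) (TiePoint.decidedByBlocks h))) := by
  intro _ p _ hF q hqp
  -- The disjunction only has to be settled densely, so either a condition below `q` forces the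
  -- first alternative or none does.
  by_cases hex : ∃ f ≤ q, TiePoint.restrictionIsNew h f
  · obtain ⟨f, hfq, hf⟩ := hex
    exact ⟨f, hfq, Or.inl hf⟩
  have hFq : TiePoint.isFunctionName h q := fun g r hr => hF g r (hr.trans hqp)
  obtain ⟨f, hfq, c, hc, hd, hs⟩ := TiePoint.exists_stable hℓ hFq fun f hf => by
    by_contra hund
    exact hex ⟨f, hf, TiePoint.restrictionIsNew_of_undecided hund⟩
  exact ⟨f, hfq, Or.inr (TiePoint.decidedByBlocks_of_stable hFq hfq hc hd hs)⟩
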